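/- Let $n\ge 0$, $T>0$, let $H_0,H_1$ be traceless skew-Hermitian complex $n\times n$ matrices and let $\rho_0,\theta$ be Hermitian $n\times n$ matrices. For a control $u\in\mathcal H:=L^2([0,T],\mathbb R)$ let $\rho$ be the (Carathéodory) solution of $$\dot\rho(t)=[H_0+u(t)H_1,\rho(t)]\quad (t\in[0,T]),\qquad \rho(0)=\rho_0,$$ where $[A,B]=AB-BA$, and put $\mathrm{End}_{\rho_0}(u):=\rho(T)$. It lies in the unitary orbit $\mathcal O(\rho_0)=\{U\rho_0U^\dagger : U\in \mathrm{SU}(n)\}$, a compact embedded submanifold of $\mathbb C^{n\times n}$. Let $J(\rho)=\mathrm{Re}\,\mathrm{tr}(\rho\theta)$ for $\rho\in\mathcal O(\rho_0)$ and $\mathcal J(u)=J(\mathrm{End}_{\rho_0}(u))$ for $u\in\mathcal H$. A control $u$ is called regular if the rank of the differential $d\,\mathrm{End}_{\rho_0}(u)$ equals $\dim\mathcal O(\rho_0)$. If $u\in\mathcal H$ is a regular control, then the following are equivalent: (a) $u$ is a critical point of $\mathcal J$, i.e. $d\mathcal J(u)=0$; (b) $\mathrm{End}_{\rho_0}(u)$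 is a critical point of $J$ on $\mathcal O(\rho_0)$, i.e. $dJ(\mathrm{End}_{\rho_0}(u))$ vanishes on the tangent space of $\mathcal O(\rho_0)$ at $\mathrm{End}_{\rho_0}(u)$; (c) $[\mathrm{End}_{\rho_0}(u),\theta]=0$. -/

import Mathlib

open MeasureTheory
open scoped Matrix Matrix.Norms.Frobenius

noncomputable section

namespace QuantumControl

variable {n : ℕ}

/-- The complex `n × n` matrices. As a real normed space it carries the Frobenius
(Hilbert–Schmidt) norm; all norms are equivalent, so none of the notions below depends on this. -/
abbrev Mat (n : ℕ) : Type := Matrix (Fin n) (Fin n) ℂ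

/-- `𝔰𝔲(n)`: the traceless skew-Hermitian matrices. -/
def IsSu (A : Mat n) : Prop := Aᴴ = -A ∧ A.trace = 0

/-- The Hilbert space of controls `L²([0,T], ℝ)`. -/
abbrev Control (T : ℝ) : Type := Lp ℝ 2 (volume.restrict (Set.Icc (0 : ℝ) T))

/-- `ρ` is, on `[0,T]`, the (Carathéodory) solution of the Liouville–von Neumann equation
`ρ'(t) = [H₀ + u(t) H₁, ρ(t)]`, `ρ(0) = ρ₀`, i.e. a continuous solution of the integrated
equation. Only the almost everywhere class of `u` on `[0,T]` and the values of `ρ` on `[0,T]`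
matter. -/
def IsTrajectory (T : ℝ) (H₀ H₁ ρ₀ : Mat n) (u : Control T) (ρ : ℝ → Mat n) : Prop :=
  ContinuousOn ρ (Set.Icc 0 T) ∧
    ∀ t ∈ Set.Icc 0 T, ρ t = ρ₀ + ∫ s in (0 : ℝ)..t, ⁅H₀ + (u s : ℝ) • H₁, ρ s⁆

/-- The trajectory of the control `u` (it exists, and it is unique on `[0,T]`). -/
def trajectory (T : ℝ) (H₀ H₁ ρ₀ : Mat n) (u : Control T) : ℝ → Mat n :=
  Classical.epsilon (IsTrajectory T H₀ H₁ ρ₀ u)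

/-- The end-point map `u ↦ ρ(T)`, regarded as a map into the ambient space of matrices. -/
def endPoint (T : ℝ) (H₀ H₁ ρ₀ : Mat n) (u : Control T) : Mat n :=
  trajectory T H₀ H₁ ρ₀ u T

/-- The unitary orbit `{U ρ₀ U† : U ∈ SU(n)}`. -/
def orbit (ρ₀ : Mat n) : Set (Mat n) :=
  {ρ | ∃ U ∈ Matrix.specialUnitaryGroup (Fin n) ℂ, ρ = U * ρ₀ * Uᴴ}

/-- The tangent space at `ρ` of the orbit, an embedded submanifold of the space of matrices:
the real span of the velocities at `ρ` of the curves that run in the orbit. -/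
def tangentSpace (ρ₀ ρ : Mat n) : Submodule ℝ (Mat n) :=
  Submodule.span ℝ
    {η | ∃ γ : ℝ → Mat n, (∀ s, γ s ∈ orbit ρ₀) ∧ γ 0 = ρ ∧ HasDerivAt γ η 0}

/-- The dimension of the orbit. The orbit is homogeneous, so that the tangent space
may be taken at `ρ₀`. -/
def orbitDim (ρ₀ : Mat n) : ℕ := Module.finrank ℝ (tangentSpace ρ₀ ρ₀)

/-- The cost function `J(ρ) = Re tr(ρ θ)`. -/
def cost (θ ρ : Mat n) : ℝ := (ρ * θ).trace.re

/-- The cost function `𝒥(u) = Re tr(End(u) θ)` on the space of controls. -/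
def controlCost (T : ℝ) (H₀ H₁ ρ₀ θ : Mat n) (u : Control T) : ℝ :=
  cost θ (endPoint T H₀ H₁ ρ₀ u)

/-- The control `u` is regular: the rank of the differential at `u` of the end-point map is the
dimension of the orbit. -/
def IsRegular (T : ℝ) (H₀ H₁ ρ₀ : Mat n) (u : Control T) : Prop :=
  Module.finrank ℝ (LinearMap.range (fderiv ℝ (endPoint T H₀ H₁ ρ₀) u).toLinearMap) =
    orbitDim ρ₀

/-- `u` is a critical point of `𝒥`: `𝒥` is Fréchet differentiable at `u`, with derivative `0`. -/
def IsCriticalControl (T : ℝ) (H₀ H₁ ρ₀ θ : Mat n) (u : Control T) : Prop :=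
  HasFDerivAt (controlCost T H₀ H₁ ρ₀ θ) (0 : Control T →L[ℝ] ℝ) u

/-- `ρ` is a critical point of the restriction of `J` to the orbit: it is a point of the orbit and
the differential of `J` at `ρ` vanishes on the tangent space of the orbit. -/
def IsCriticalState (ρ₀ θ ρ : Mat n) : Prop :=
  ρ ∈ orbit ρ₀ ∧ ∀ η ∈ tangentSpace ρ₀ ρ, fderiv ℝ (cost θ) ρ η = 0

end QuantumControl

end

/-! The equation is linear in the state and affine in the control, so its integrated form reads `(1
- K_u) x = const`, with `K_u` a Volterra operator on continuous functions. Some power of `K_u` is a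
strict contraction (`exists_norm_linearOp_pow_sq_le`), hence `1 - K_u` is invertible. This gives
existence and uniqueness; since inversion is differentiable at units, the end-point map is Fréchet
differentiable on all of `L²`.

The end point is `U ρ₀ Uᴴ` with `U` the propagator, which is unitary (`propagator_spec`); so the
end-point map takes values in the orbit and the range of its differential lies in the tangent space.
Regularity forces equality by dimension. As `J` is linear, `d𝒥(u)` is `J` composed with that
differential, so it vanishes iff `J` vanishes on the tangent space.

If `J` vanishes there, testing on the tangent vector `[[ρ,θ],ρ]` gives `-‖[ρ,θ]‖² = 0`. Conversely,
in an eigenbasis of `ρ` a velocity of the orbit vanishes at entries joining equal eigenvalues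
(`apply_eq_zero_of_isospectral`), while a `θ` commuting with `ρ` vanishes at all others, so `tr(ηθ)
= 0`. Tangent vectors come from arbitrary curves in the orbit, with no lift to `SU(n)`;
isospectrality replaces the lift. -/

noncomputable section

namespace QuantumControl

/-! ### Linear Volterra equations with `L²` coefficients. -/

section Volterra

variable {E : Type*} [NormedAddCommGroup E] {T : ℝ}

/-- The extension of a continuous function on `[0,T]` to the line, constant on either side. -/
def extend (hT : 0 ≤ T) (f : C(Set.Icc (0 : ℝ) T, E)) : ℝ → E := Set.IccExtend hT f

lemma continuous_extend (hT : 0 ≤ T) (f : C(Set.Icc (0 : ℝ) T, E)) :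
    Continuous (extend hT f) := f.continuous.Icc_extend'

lemma extend_of_mem (hT : 0 ≤ T) (f : C(Set.Icc (0 : ℝ) T, E)) {t : ℝ}
    (ht : t ∈ Set.Icc 0 T) : extend hT f t = f ⟨t, ht⟩ := Set.IccExtend_of_mem hT f ht

lemma norm_extend_le (hT : 0 ≤ T) (f : C(Set.Icc (0 : ℝ) T, E)) (t : ℝ) :
    ‖extend hT f t‖ ≤ ‖f‖ := f.norm_coe_le_norm _

variable [NormedSpace ℝ E]

lemma control_integrable (v : Control T) :
    Integrable v (volume.restrict (Set.Icc (0 : ℝ) T)) :=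
  (Lp.memLp v).integrable one_le_two

lemma integrable_smul_extend (hT : 0 ≤ T) (v : Control T) (f : C(Set.Icc (0 : ℝ) T, E)) :
    Integrable (fun s => v s • extend hT f s) (volume.restrict (Set.Icc (0 : ℝ) T)) :=
  (control_integrable v).smul_bdd ‖f‖ (continuous_extend hT f).aestronglyMeasurable
    (ae_of_all _ (norm_extend_le hT f))

/-- The Volterra operator `f ↦ (t ↦ ∫₀ᵗ v f)`. -/
def volterraFun (hT : 0 ≤ T) (v : Control T) (f : C(Set.Icc (0 : ℝ) T, E)) :
    C(Set.Icc (0 : ℝ) T, E) where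
  toFun t := ∫ s in (0 : ℝ)..t, v s • extend hT f s ∂(volume.restrict (Set.Icc (0 : ℝ) T))
  continuous_toFun := (intervalIntegral.continuous_primitive
    (fun _ _ => (integrable_smul_extend hT v f).intervalIntegrable) 0).comp continuous_subtype_val

lemma intervalIntegral_restrict_Icc {t : ℝ} (ht : t ∈ Set.Icc 0 T) (g : ℝ → E) :
    ∫ s in (0 : ℝ)..t, g s ∂(volume.restrict (Set.Icc (0 : ℝ) T)) = ∫ s in (0 : ℝ)..t, g s := by
  rw [intervalIntegral.integral_of_le ht.1, intervalIntegral.integral_of_le ht.1,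
    Measure.restrict_restrict measurableSet_Ioc, Set.inter_eq_left.2]
  exact fun s hs => ⟨hs.1.le, hs.2.trans ht.2⟩

lemma norm_sq_control (v : Control T) :
    ‖v‖ ^ 2 = ∫ s, ‖v s‖ ^ 2 ∂(volume.restrict (Set.Icc (0 : ℝ) T)) := by
  rw [← real_inner_self_eq_norm_sq, L2.inner_def]
  simp

/-- The Cauchy–Schwarz estimate for the Volterra operator. -/
lemma norm_volterraFun_sq_le (hT : 0 ≤ T) (v : Control T) (f : C(Set.Icc (0 : ℝ) T, E))
    (t : Set.Icc (0 : ℝ) T) :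
    ‖volterraFun hT v f t‖ ^ 2 ≤ ‖v‖ ^ 2 * ∫ s in (0 : ℝ)..t, ‖extend hT f s‖ ^ 2 := by
  set μ := volume.restrict (Set.Icc (0 : ℝ) T) with hμ
  set ν := μ.restrict (Set.Ioc (0 : ℝ) t) with hν
  have hv : MemLp (fun s => ‖v s‖) (ENNReal.ofReal 2) ν := by
    have := ((Lp.memLp v).norm).restrict (Set.Ioc (0 : ℝ) t)
    rwa [ENNReal.ofReal_ofNat]
  have hf : MemLp (fun s => ‖extend hT f s‖) (ENNReal.ofReal 2) ν := by
    refine MemLp.of_bound (C := ‖f‖)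
      (continuous_extend hT f).norm.aestronglyMeasurable (ae_of_all _ fun s => ?_)
    simpa using norm_extend_le hT f s
  have key := integral_mul_le_Lp_mul_Lq_of_nonneg (μ := ν) Real.HolderConjugate.two_two
    (f := fun s => ‖v s‖) (g := fun s => ‖extend hT f s‖)
    (ae_of_all _ fun s => norm_nonneg _) (ae_of_all _ fun s => norm_nonneg _) hv hf
  have h1 : ‖volterraFun hT v f t‖ ≤ ∫ s, ‖v s‖ * ‖extend hT f s‖ ∂ν := by
    change ‖∫ s in (0 : ℝ)..t, v s • extend hT f s ∂μ‖ ≤ _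
    rw [intervalIntegral.integral_of_le t.2.1]
    simpa only [norm_smul] using norm_integral_le_integral_norm (μ := ν)
      (fun s => v s • extend hT f s)
  have h2 := h1.trans key
  have e1 : ∫ s, ‖v s‖ ^ (2 : ℝ) ∂ν ≤ ‖v‖ ^ 2 := by
    rw [norm_sq_control]
    simp only [Real.rpow_two]
    exact setIntegral_le_integral (Lp.memLp v).integrable_norm_pow'
      (ae_of_all _ fun s => by positivity)
  have e2 : ∫ s, ‖extend hT f s‖ ^ (2 : ℝ) ∂ν = ∫ s in (0 : ℝ)..t, ‖extend hT f s‖ ^ 2 := by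
    simp only [Real.rpow_two]
    rw [← intervalIntegral_restrict_Icc t.2, intervalIntegral.integral_of_le t.2.1]
  rw [← Real.sqrt_eq_rpow, ← Real.sqrt_eq_rpow, e2] at h2
  have h0 : 0 ≤ ∫ s in (0 : ℝ)..t, ‖extend hT f s‖ ^ 2 :=
    intervalIntegral.integral_nonneg t.2.1 fun s _ => by positivity
  have h00 : 0 ≤ ∫ s, ‖v s‖ ^ (2 : ℝ) ∂ν := integral_nonneg fun s => by positivity
  calc ‖volterraFun hT v f t‖ ^ 2 ≤ (√(∫ s, ‖v s‖ ^ (2 : ℝ) ∂ν) *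
        √(∫ s in (0 : ℝ)..t, ‖extend hT f s‖ ^ 2)) ^ 2 := by gcongr
    _ = (∫ s, ‖v s‖ ^ (2 : ℝ) ∂ν) * ∫ s in (0 : ℝ)..t, ‖extend hT f s‖ ^ 2 := by
      rw [mul_pow, Real.sq_sqrt h00, Real.sq_sqrt h0]
    _ ≤ _ := by gcongr

lemma norm_volterraFun_le (hT : 0 ≤ T) (v : Control T) (f : C(Set.Icc (0 : ℝ) T, E)) :
    ‖volterraFun hT v f‖ ≤ √T * ‖v‖ * ‖f‖ := by
  rw [ContinuousMap.norm_le _ (by positivity)]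
  intro t
  refine abs_le_of_sq_le_sq' ?_ (by positivity) |>.2
  refine (norm_volterraFun_sq_le hT v f t).trans ?_
  rw [mul_pow, mul_pow, Real.sq_sqrt hT]
  have : ∫ s in (0 : ℝ)..t, ‖extend hT f s‖ ^ 2 ≤ ∫ s in (0 : ℝ)..t, ‖f‖ ^ 2 := by
    refine intervalIntegral.integral_mono_on t.2.1
      (((continuous_extend hT f).norm.pow 2).intervalIntegrable _ _) (by simp) fun s _ => ?_
    have := norm_extend_le hT f s
    gcongr
  rw [intervalIntegral.integral_const, smul_eq_mul, sub_zero] at this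
  calc _ ≤ ‖v‖ ^ 2 * (T * ‖f‖ ^ 2) := by
        gcongr
        exact this.trans (by gcongr; exact t.2.2)
    _ = _ := by ring

lemma volterraFun_apply (hT : 0 ≤ T) (v : Control T) (f : C(Set.Icc (0 : ℝ) T, E))
    (t : Set.Icc (0 : ℝ) T) : volterraFun hT v f t =
      ∫ s in (0 : ℝ)..t, v s • extend hT f s ∂(volume.restrict (Set.Icc (0 : ℝ) T)) := rfl

lemma volterraFun_add_left (hT : 0 ≤ T) (v w : Control T) (f : C(Set.Icc (0 : ℝ) T, E)) :
    volterraFun hT (v + w) f = volterraFun hT v f + volterraFun hT w f := by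
  ext t
  rw [ContinuousMap.add_apply]
  simp only [volterraFun_apply]
  rw [← intervalIntegral.integral_add (integrable_smul_extend hT v f).intervalIntegrable
    (integrable_smul_extend hT w f).intervalIntegrable]
  refine intervalIntegral.integral_congr_ae ?_
  filter_upwards [Lp.coeFn_add v w] with s hs _
  rw [hs, Pi.add_apply, add_smul]

lemma volterraFun_smul_left (hT : 0 ≤ T) (c : ℝ) (v : Control T)
    (f : C(Set.Icc (0 : ℝ) T, E)) :
    volterraFun hT (c • v) f = c • volterraFun hT v f := by
  ext t
  rw [ContinuousMap.smul_apply]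
  simp only [volterraFun_apply]
  rw [← intervalIntegral.integral_smul]
  refine intervalIntegral.integral_congr_ae ?_
  filter_upwards [Lp.coeFn_smul c v] with s hs _
  rw [hs, Pi.smul_apply, smul_assoc]

lemma volterraFun_add_right (hT : 0 ≤ T) (v : Control T) (f g : C(Set.Icc (0 : ℝ) T, E)) :
    volterraFun hT v (f + g) = volterraFun hT v f + volterraFun hT v g := by
  ext t
  rw [ContinuousMap.add_apply]
  simp only [volterraFun_apply]
  rw [← intervalIntegral.integral_add (integrable_smul_extend hT v f).intervalIntegrable
    (integrable_smul_extend hT v g).intervalIntegrable]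
  exact intervalIntegral.integral_congr fun s _ => smul_add _ _ _

lemma volterraFun_smul_right (hT : 0 ≤ T) (c : ℝ) (v : Control T)
    (f : C(Set.Icc (0 : ℝ) T, E)) :
    volterraFun hT v (c • f) = c • volterraFun hT v f := by
  ext t
  rw [ContinuousMap.smul_apply]
  simp only [volterraFun_apply]
  rw [← intervalIntegral.integral_smul]
  exact intervalIntegral.integral_congr fun s _ => smul_comm _ _ _

/-- The Volterra operator as a continuous bilinear map. -/
def volterra (hT : 0 ≤ T) :
    Control T →L[ℝ] C(Set.Icc (0 : ℝ) T, E) →L[ℝ] C(Set.Icc (0 : ℝ) T, E) :=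
  LinearMap.mkContinuous₂
    (LinearMap.mk₂ ℝ (volterraFun hT) (volterraFun_add_left hT) (volterraFun_smul_left hT)
      (volterraFun_add_right hT) (volterraFun_smul_right hT))
    (√T) (norm_volterraFun_le hT)

/-- The constant control `1`. -/
def oneControl (T : ℝ) : Control T := Lp.const 2 (volume.restrict (Set.Icc (0 : ℝ) T)) (1 : ℝ)

/-- The operator `x ↦ (t ↦ ∫₀ᵗ u(s) b x(s) ds)`, depending linearly on `u`. -/
def volterraComp (hT : 0 ≤ T) (b : E →L[ℝ] E) :
    Control T →L[ℝ] C(Set.Icc (0 : ℝ) T, E) →L[ℝ] C(Set.Icc (0 : ℝ) T, E) :=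
  (ContinuousLinearMap.compL ℝ C(Set.Icc (0 : ℝ) T, E) C(Set.Icc (0 : ℝ) T, E)
    C(Set.Icc (0 : ℝ) T, E)).flip (b.compLeftContinuous ℝ _) ∘L volterra hT

/-- The operator `x ↦ (t ↦ ∫₀ᵗ (a + u(s) b) x(s) ds)`. -/
def linearOp (hT : 0 ≤ T) (a b : E →L[ℝ] E) (u : Control T) :
    C(Set.Icc (0 : ℝ) T, E) →L[ℝ] C(Set.Icc (0 : ℝ) T, E) :=
  volterraComp hT a (oneControl T) + volterraComp hT b u

lemma extend_compLeftContinuous (hT : 0 ≤ T) (a : E →L[ℝ] E) (f : C(Set.Icc (0 : ℝ) T, E))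
    (s : ℝ) : extend hT (a.compLeftContinuous ℝ _ f) s = a (extend hT f s) := rfl

/-- The drift `a` is treated as a control term with constant control `1`, so one bilinear operator
serves both summands. -/
lemma linearOp_apply (hT : 0 ≤ T) (a b : E →L[ℝ] E) (u : Control T)
    (f : C(Set.Icc (0 : ℝ) T, E)) (t : Set.Icc (0 : ℝ) T) :
    linearOp hT a b u f t =
      ∫ s in (0 : ℝ)..t, (a (extend hT f s) + u s • b (extend hT f s)) := by
  change volterraFun hT (oneControl T) (a.compLeftContinuous ℝ _ f) t +
    volterraFun hT u (b.compLeftContinuous ℝ _ f) t = _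
  simp only [volterraFun_apply]
  rw [← intervalIntegral.integral_add (integrable_smul_extend hT _ _).intervalIntegrable
    (integrable_smul_extend hT _ _).intervalIntegrable, ← intervalIntegral_restrict_Icc t.2]
  refine intervalIntegral.integral_congr_ae ?_
  filter_upwards [Lp.coeFn_const (p := 2) (μ := volume.restrict (Set.Icc (0 : ℝ) T)) (1 : ℝ)]
    with s hs _
  rw [extend_compLeftContinuous, extend_compLeftContinuous, oneControl, hs, Function.const_apply,
    one_smul]

lemma norm_linearOp_sq_le (hT : 0 ≤ T) (a b : E →L[ℝ] E) (u : Control T) :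
    ∃ C : ℝ, 0 ≤ C ∧ ∀ (f : C(Set.Icc (0 : ℝ) T, E)) (t : Set.Icc (0 : ℝ) T),
      ‖linearOp hT a b u f t‖ ^ 2 ≤ C * ∫ s in (0 : ℝ)..t, ‖extend hT f s‖ ^ 2 := by
  -- From `‖x + y‖² ≤ 2‖x‖² + 2‖y‖²` and Cauchy–Schwarz on each summand.
  refine ⟨2 * (‖oneControl T‖ ^ 2 * ‖a‖ ^ 2) + 2 * (‖u‖ ^ 2 * ‖b‖ ^ 2), by positivity,
    fun f t => ?_⟩
  have key (v : Control T) (c : E →L[ℝ] E) :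
      ‖volterraFun hT v (c.compLeftContinuous ℝ _ f) t‖ ^ 2 ≤
        ‖v‖ ^ 2 * ‖c‖ ^ 2 * ∫ s in (0 : ℝ)..t, ‖extend hT f s‖ ^ 2 := by
    refine (norm_volterraFun_sq_le hT v _ t).trans ?_
    rw [mul_assoc, ← intervalIntegral.integral_const_mul (‖c‖ ^ 2)]
    refine mul_le_mul_of_nonneg_left ?_ (sq_nonneg ‖v‖)
    refine intervalIntegral.integral_mono_on t.2.1
      (((continuous_extend hT _).norm.pow 2).intervalIntegrable _ _)
      ((continuous_const.mul ((continuous_extend hT _).norm.pow 2)).intervalIntegrable _ _)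
      fun s _ => ?_
    rw [extend_compLeftContinuous, ← mul_pow]
    gcongr
    exact c.le_opNorm _
  change ‖volterraFun hT (oneControl T) (a.compLeftContinuous ℝ _ f) t +
    volterraFun hT u (b.compLeftContinuous ℝ _ f) t‖ ^ 2 ≤ _
  have h1 := key (oneControl T) a
  have h2 := key u b
  set x := volterraFun hT (oneControl T) (a.compLeftContinuous ℝ _ f) t
  set y := volterraFun hT u (b.compLeftContinuous ℝ _ f) t
  have h3 : ‖x + y‖ ^ 2 ≤ (‖x‖ + ‖y‖) ^ 2 := by gcongr; exact norm_add_le _ _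
  nlinarith [sq_nonneg (‖x‖ - ‖y‖)]

/-- The squared bound can be iterated: each application integrates `s ^ k` once more, which produces
the factorial. -/
lemma exists_norm_linearOp_pow_sq_le (hT : 0 ≤ T) (a b : E →L[ℝ] E) (u : Control T) :
    ∃ C : ℝ, 0 ≤ C ∧ ∀ (k : ℕ) (f : C(Set.Icc (0 : ℝ) T, E)) (t : Set.Icc (0 : ℝ) T),
      ‖(linearOp hT a b u ^ k) f t‖ ^ 2 ≤ ‖f‖ ^ 2 * ((C * t) ^ k / k.factorial) := by
  obtain ⟨C, hC, h⟩ := norm_linearOp_sq_le hT a b u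
  refine ⟨C, hC, fun k f => ?_⟩
  induction k with
  | zero =>
    intro t
    have := f.norm_coe_le_norm t
    simp only [pow_zero, Nat.factorial_zero, Nat.cast_one, div_one, mul_one]
    change ‖f t‖ ^ 2 ≤ _
    gcongr
  | succ k ih =>
    intro t
    rw [show (linearOp hT a b u ^ (k + 1)) f = linearOp hT a b u ((linearOp hT a b u ^ k) f) by
      rw [pow_succ']; rfl]
    refine (h _ t).trans ?_
    have : ∫ s in (0 : ℝ)..t, ‖extend hT ((linearOp hT a b u ^ k) f) s‖ ^ 2 ≤
        ∫ s in (0 : ℝ)..t, ‖f‖ ^ 2 * C ^ k / k.factorial * s ^ k := by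
      refine intervalIntegral.integral_mono_on t.2.1
        (((continuous_extend hT _).norm.pow 2).intervalIntegrable _ _)
        ((continuous_const.mul (continuous_id.pow k)).intervalIntegrable _ _) fun s hs => ?_
      rw [extend_of_mem hT _ ⟨hs.1, hs.2.trans t.2.2⟩]
      refine (ih _).trans (le_of_eq ?_)
      ring
    rw [intervalIntegral.integral_const_mul, integral_pow] at this
    refine (mul_le_mul_of_nonneg_left this hC).trans (le_of_eq ?_)
    rw [Nat.factorial_succ]
    push_cast
    have : (k.factorial : ℝ) ≠ 0 := by positivity
    field_simp
    ring

/-- The factorial makes some power `K ^ k` a strict contraction. Then `1 - K ^ k` is a unit, and `1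
- K` is one of its two commuting factors in the geometric sum. -/
lemma isUnit_one_sub_linearOp [CompleteSpace E] (hT : 0 ≤ T) (a b : E →L[ℝ] E)
    (u : Control T) : IsUnit (1 - linearOp hT a b u) := by
  obtain ⟨C, hC, h⟩ := exists_norm_linearOp_pow_sq_le hT a b u
  set K := linearOp hT a b u
  have hlim := FloorSemiring.tendsto_pow_div_factorial_atTop (C * T)
  -- The bound is on squared norms, so `1 / 4` yields `‖K ^ k‖ ≤ 1 / 2`.
  obtain ⟨k, hk⟩ := (hlim.eventually_lt_const (show (0 : ℝ) < 1 / 4 by norm_num)).exists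
  have hnorm : ‖K ^ k‖ ≤ 1 / 2 := by
    refine ContinuousLinearMap.opNorm_le_bound _ (by norm_num) fun f => ?_
    rw [ContinuousMap.norm_le _ (by positivity)]
    intro t
    refine abs_le_of_sq_le_sq' ?_ (by positivity) |>.2
    refine (h k f t).trans ?_
    have : (C * t) ^ k / k.factorial ≤ (C * T) ^ k / k.factorial := by
      have := t.2.1
      have := t.2.2
      gcongr
    calc ‖f‖ ^ 2 * ((C * t) ^ k / k.factorial) ≤ ‖f‖ ^ 2 * (1 / 4) := by
          exact mul_le_mul_of_nonneg_left (this.trans hk.le) (sq_nonneg _)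
      _ = _ := by ring
  have hunit : IsUnit (1 - K ^ k) := isUnit_one_sub_of_norm_lt_one
    (R := C(Set.Icc (0 : ℝ) T, E) →L[ℝ] C(Set.Icc (0 : ℝ) T, E)) (hnorm.trans_lt (by norm_num))
  have hgeom : (1 - K) * ∑ i ∈ Finset.range k, K ^ i = 1 - K ^ k := mul_neg_geom_sum K k
  have hcomm : Commute (1 - K) (∑ i ∈ Finset.range k, K ^ i) :=
    Commute.sum_right _ _ _ fun i _ => ((Commute.one_left _).sub_left (Commute.refl K)).pow_right i
  rw [← hgeom] at hunit
  exact (hcomm.isUnit_mul_iff.1 hunit).1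

/-- The solution of the linear equation `x(t) = x₀ + ∫₀ᵗ (a + u(s) b) x(s) ds`. -/
def linearSol (hT : 0 ≤ T) (a b : E →L[ℝ] E) (x₀ : E) (u : Control T) :
    C(Set.Icc (0 : ℝ) T, E) :=
  Ring.inverse (1 - linearOp hT a b u) (ContinuousMap.const _ x₀)

/-- `x` solves `x(t) = x₀ + ∫₀ᵗ (a + u(s) b) x(s) ds` on `[0,T]`. -/
def IsLinearSol (T : ℝ) (a b : E →L[ℝ] E) (x₀ : E) (u : Control T)
    (x : ℝ → E) : Prop :=
  ContinuousOn x (Set.Icc 0 T) ∧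
    ∀ t ∈ Set.Icc 0 T, x t = x₀ + ∫ s in (0 : ℝ)..t, (a (x s) + (u s : ℝ) • b (x s))

lemma isLinearSol_linearSol [CompleteSpace E] (hT : 0 ≤ T) (a b : E →L[ℝ] E) (x₀ : E)
    (u : Control T) : IsLinearSol T a b x₀ u (extend hT (linearSol hT a b x₀ u)) := by
  refine ⟨(continuous_extend hT _).continuousOn, fun t ht => ?_⟩
  have h := DFunLike.congr_fun
    (Ring.mul_inverse_cancel _ (isUnit_one_sub_linearOp hT a b u)) (ContinuousMap.const _ x₀)
  have h1 : linearSol hT a b x₀ u - linearOp hT a b u (linearSol hT a b x₀ u) =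
    ContinuousMap.const _ x₀ := h
  have h2 := DFunLike.congr_fun h1 ⟨t, ht⟩
  rw [ContinuousMap.sub_apply, ContinuousMap.const_apply, linearOp_apply, sub_eq_iff_eq_add] at h2
  rw [extend_of_mem hT _ ht]
  exact h2

lemma IsLinearSol.eq_linearSol [CompleteSpace E] (hT : 0 ≤ T) {a b : E →L[ℝ] E} {x₀ : E}
    {u : Control T} {x : ℝ → E} (hx : IsLinearSol T a b x₀ u x) (t : Set.Icc (0 : ℝ) T) :
    x t = linearSol hT a b x₀ u t := by
  let f : C(Set.Icc (0 : ℝ) T, E) := ⟨fun t => x t, hx.1.domRestrict⟩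
  have h1 : (1 - linearOp hT a b u) f = ContinuousMap.const _ x₀ := by
    ext t
    change f t - linearOp hT a b u f t = x₀
    rw [linearOp_apply, sub_eq_iff_eq_add]
    refine (hx.2 t t.2).trans ?_
    congr 1
    refine intervalIntegral.integral_congr fun s hs => ?_
    rw [Set.uIcc_of_le t.2.1] at hs
    simp only [extend_of_mem hT f ⟨hs.1, hs.2.trans t.2.2⟩]
    rfl
  have h2 : f = linearSol hT a b x₀ u := by
    rw [linearSol, ← h1]
    exact (DFunLike.congr_fun
      (Ring.inverse_mul_cancel _ (isUnit_one_sub_linearOp hT a b u)) f).symm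
  exact DFunLike.congr_fun h2 t

/-- An affine map followed by inversion, which is differentiable at units, and by evaluation at `c`.
-/
lemma differentiableAt_inverse_one_sub_apply {F X : Type*} [NormedAddCommGroup F]
    [NormedSpace ℝ F] [NormedAddCommGroup X] [NormedSpace ℝ X] [CompleteSpace X]
    (K : X →L[ℝ] X) (L : F →L[ℝ] X →L[ℝ] X) (c : X) (u : F) (h : IsUnit (1 - (K + L u))) :
    DifferentiableAt ℝ (fun v => Ring.inverse (1 - (K + L v)) c) u := by
  have h1 : DifferentiableAt ℝ (fun v => Ring.inverse (1 - (K + L v))) u :=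
    DifferentiableAt.comp (g := Ring.inverse) u (differentiableAt_inverse (𝕜 := ℝ) h)
      ((L.differentiableAt.const_add _).const_sub _)
  exact h1.clm_apply (differentiableAt_const c)

lemma differentiable_linearSol [CompleteSpace E] (hT : 0 ≤ T) (a b : E →L[ℝ] E) (x₀ : E) :
    Differentiable ℝ (linearSol hT a b x₀) := fun u =>
  differentiableAt_inverse_one_sub_apply (volterraComp hT a (oneControl T)) (volterraComp hT b)
    (ContinuousMap.const _ x₀) u (isUnit_one_sub_linearOp hT a b u)

lemma differentiable_linearSol_apply [CompleteSpace E] (hT : 0 ≤ T) (a b : E →L[ℝ] E) (x₀ : E)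
    (t : Set.Icc (0 : ℝ) T) : Differentiable ℝ fun u => linearSol hT a b x₀ u t :=
  Differentiable.comp (g := ContinuousMap.evalCLM ℝ t)
    (ContinuousMap.evalCLM (M := E) ℝ t).differentiable (differentiable_linearSol hT a b x₀)

end Volterra

/-! ### Classical solutions for continuous controls. -/

section ContinuousControl

variable {E : Type*} [NormedAddCommGroup E] [NormedSpace ℝ E] {T : ℝ}

lemma intervalIntegral_congr_control {u : Control T} {f : ℝ → ℝ}
    (huf : u =ᵐ[volume.restrict (Set.Icc (0 : ℝ) T)] f) (g h : ℝ → E) {t : ℝ}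
    (ht : t ∈ Set.Icc 0 T) :
    ∫ s in (0 : ℝ)..t, (g s + u s • h s) = ∫ s in (0 : ℝ)..t, (g s + f s • h s) := by
  rw [← intervalIntegral_restrict_Icc ht, ← intervalIntegral_restrict_Icc ht]
  refine intervalIntegral.integral_congr_ae ?_
  filter_upwards [huf] with s hs _
  rw [hs]

variable [CompleteSpace E]

/-- For a continuous control, the linear equation has a classical solution. -/
lemma exists_hasDerivAt_linearSol (hT : 0 ≤ T) (a b : E →L[ℝ] E) (x₀ : E) {u : Control T}
    {f : ℝ → ℝ} (hf : Continuous f) (huf : u =ᵐ[volume.restrict (Set.Icc (0 : ℝ) T)] f) :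
    ∃ y : ℝ → E, y 0 = x₀ ∧ (∀ t ∈ Set.Icc 0 T, HasDerivAt y (a (y t) + f t • b (y t)) t) ∧
      ∀ t : Set.Icc (0 : ℝ) T, y t = linearSol hT a b x₀ u t := by
  set x := extend hT (linearSol hT a b x₀ u) with hx
  have hxc : Continuous x := continuous_extend hT _
  have hc : Continuous fun s => a (x s) + f s • b (x s) :=
    (a.continuous.comp hxc).add (hf.smul (b.continuous.comp hxc))
  have heq : ∀ t ∈ Set.Icc 0 T, x₀ + ∫ s in (0 : ℝ)..t, (a (x s) + f s • b (x s)) = x t := by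
    intro t ht
    rw [← intervalIntegral_congr_control huf (fun s => a (x s)) (fun s => b (x s)) ht]
    exact ((isLinearSol_linearSol hT a b x₀ u).2 t ht).symm
  refine ⟨fun t => x₀ + ∫ s in (0 : ℝ)..t, (a (x s) + f s • b (x s)), by simp, fun t ht => ?_,
    fun t => ?_⟩
  · simp only [heq t ht]
    exact (intervalIntegral.integral_hasDerivAt_right (hc.intervalIntegrable _ _)
      hc.stronglyMeasurable.stronglyMeasurableAtFilter hc.continuousAt).const_add _
  · simp only [heq t t.2]
    exact extend_of_mem hT _ t.2

/-- For a continuous control, a classical solution of the linear equation is the solution. -/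
lemma eq_linearSol_of_hasDerivAt (hT : 0 ≤ T) {a b : E →L[ℝ] E} {x₀ : E} {u : Control T}
    {f : ℝ → ℝ} (hf : Continuous f) (huf : u =ᵐ[volume.restrict (Set.Icc (0 : ℝ) T)] f)
    {y : ℝ → E} (hy0 : y 0 = x₀)
    (hy : ∀ t ∈ Set.Icc 0 T, HasDerivAt y (a (y t) + f t • b (y t)) t)
    (t : Set.Icc (0 : ℝ) T) : y t = linearSol hT a b x₀ u t := by
  have hyc : ContinuousOn y (Set.Icc 0 T) := fun t ht => (hy t ht).continuousAt.continuousWithinAt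
  refine IsLinearSol.eq_linearSol hT ⟨hyc, fun t ht => ?_⟩ t
  have hsub : Set.uIcc 0 t ⊆ Set.Icc 0 T := by
    rw [Set.uIcc_of_le ht.1]
    exact Set.Icc_subset_Icc_right ht.2
  rw [intervalIntegral_congr_control huf (fun s => a (y s)) (fun s => b (y s)) ht,
    intervalIntegral.integral_eq_sub_of_hasDerivAt (fun s hs => hy s (hsub hs)), hy0]
  · abel
  · refine ContinuousOn.intervalIntegrable ?_
    have := hyc.mono hsub
    exact (a.continuous.comp_continuousOn this).add
      (hf.continuousOn.smul (b.continuous.comp_continuousOn this))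

end ContinuousControl

/-! ### The end-point map and the unitary propagator. -/

variable {n : ℕ} {T : ℝ}

/-- Left multiplication by a matrix. -/
def mulLeftCLM (H : Mat n) : Mat n →L[ℝ] Mat n := ContinuousLinearMap.mul ℝ (Mat n) H

/-- The commutator with a matrix. -/
def bracketCLM (H : Mat n) : Mat n →L[ℝ] Mat n :=
  ContinuousLinearMap.mul ℝ (Mat n) H - (ContinuousLinearMap.mul ℝ (Mat n)).flip H

lemma smul_lie_add (H₀ H₁ X : Mat n) (c : ℝ) :
    ⁅H₀ + c • H₁, X⁆ = H₀ * X - X * H₀ + c • (H₁ * X - X * H₁) := by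
  rw [Ring.lie_def, add_mul, mul_add, smul_mul_assoc, mul_smul_comm, smul_sub]
  abel

lemma isTrajectory_iff (H₀ H₁ ρ₀ : Mat n) (u : Control T) (ρ : ℝ → Mat n) :
    IsTrajectory T H₀ H₁ ρ₀ u ρ ↔ IsLinearSol T (bracketCLM H₀) (bracketCLM H₁) ρ₀ u ρ := by
  simp only [IsTrajectory, smul_lie_add]
  exact Iff.rfl

/-- Existence makes the chosen function a genuine trajectory; uniqueness fixes its value at `T`. -/
lemma endPoint_eq_linearSol (hT : 0 ≤ T) (H₀ H₁ ρ₀ : Mat n) (u : Control T) :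
    endPoint T H₀ H₁ ρ₀ u =
      linearSol hT (bracketCLM H₀) (bracketCLM H₁) ρ₀ u ⟨T, Set.right_mem_Icc.2 hT⟩ := by
  have h : IsTrajectory T H₀ H₁ ρ₀ u (trajectory T H₀ H₁ ρ₀ u) :=
    Classical.epsilon_spec ⟨_, (isTrajectory_iff H₀ H₁ ρ₀ u _).2 (isLinearSol_linearSol hT _ _ _ u)⟩
  exact ((isTrajectory_iff H₀ H₁ ρ₀ u _).1 h).eq_linearSol hT ⟨T, Set.right_mem_Icc.2 hT⟩

lemma differentiable_endPoint (hT : 0 ≤ T) (H₀ H₁ ρ₀ : Mat n) :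
    Differentiable ℝ (endPoint T H₀ H₁ ρ₀) := by
  rw [funext (endPoint_eq_linearSol hT H₀ H₁ ρ₀)]
  exact differentiable_linearSol_apply hT _ _ _ _

/-- The value at time `T` of the solution of `U' = (H₀ + u H₁) U`, `U(0) = 1`. -/
def propagator (hT : 0 ≤ T) (H₀ H₁ : Mat n) (u : Control T) : Mat n :=
  linearSol hT (mulLeftCLM H₀) (mulLeftCLM H₁) 1 u ⟨T, Set.right_mem_Icc.2 hT⟩

lemma continuous_propagator (hT : 0 ≤ T) (H₀ H₁ : Mat n) : Continuous (propagator hT H₀ H₁) :=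
  (differentiable_linearSol_apply hT _ _ _ _).continuous

/-- With a continuous control everything can be differentiated in `t`. Skewness of the generator
makes `Uᴴ U` constant, and `U ρ₀ Uᴴ` solves the equation of `ρ`. -/
lemma propagator_of_continuous (hT : 0 ≤ T) {H₀ H₁ : Mat n} (hH₀ : IsSu H₀) (hH₁ : IsSu H₁)
    (ρ₀ : Mat n) {u : Control T} {f : ℝ → ℝ} (hf : Continuous f)
    (huf : u =ᵐ[volume.restrict (Set.Icc (0 : ℝ) T)] f) :
    (propagator hT H₀ H₁ u)ᴴ * propagator hT H₀ H₁ u = 1 ∧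
      endPoint T H₀ H₁ ρ₀ u = propagator hT H₀ H₁ u * ρ₀ * (propagator hT H₀ H₁ u)ᴴ := by
  obtain ⟨U, hU0, hU, hUsol⟩ :=
    exists_hasDerivAt_linearSol hT (mulLeftCLM H₀) (mulLeftCLM H₁) 1 hf huf
  have hprop : propagator hT H₀ H₁ u = U T := (hUsol ⟨T, Set.right_mem_Icc.2 hT⟩).symm
  have hH : ∀ t, (H₀ + f t • H₁)ᴴ = -(H₀ + f t • H₁) := fun t => by
    rw [Matrix.conjTranspose_add, Matrix.conjTranspose_smul, hH₀.1, hH₁.1, star_trivial, smul_neg,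
      neg_add]
  have hU' : ∀ t ∈ Set.Icc 0 T, HasDerivAt U ((H₀ + f t • H₁) * U t) t := fun t ht => by
    have : HasDerivAt U (H₀ * U t + f t • (H₁ * U t)) t := hU t ht
    rwa [← smul_mul_assoc, ← add_mul] at this
  have hUs : ∀ t ∈ Set.Icc 0 T, HasDerivAt (fun t => (U t)ᴴ) (-((U t)ᴴ * (H₀ + f t • H₁))) t :=
    fun t ht => by
      have := (hU' t ht).star
      rwa [Matrix.star_eq_conjTranspose, Matrix.conjTranspose_mul, hH, mul_neg] at this
  rw [hprop]
  constructor
  · have hW : ∀ t ∈ Set.Icc 0 T, HasDerivAt (fun t => (U t)ᴴ * U t) 0 t := fun t ht => by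
      have := (hUs t ht).mul (hU' t ht)
      rwa [neg_mul, mul_assoc, neg_add_cancel] at this
    have := constant_of_has_deriv_right_zero
      (fun t ht => (hW t ht).continuousAt.continuousWithinAt)
      (fun t ht => (hW t (Set.Ico_subset_Icc_self ht)).hasDerivWithinAt) T
      (Set.right_mem_Icc.2 hT)
    simpa [hU0] using this
  · rw [endPoint_eq_linearSol hT]
    refine (eq_linearSol_of_hasDerivAt hT hf huf (y := fun t => U t * ρ₀ * (U t)ᴴ) (by simp [hU0])
      (fun t ht => ?_) ⟨T, Set.right_mem_Icc.2 hT⟩).symm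
    have := ((hU' t ht).mul_const ρ₀).mul (hUs t ht)
    have heq : (H₀ + f t • H₁) * U t * ρ₀ * (U t)ᴴ + U t * ρ₀ * -((U t)ᴴ * (H₀ + f t • H₁)) =
        H₀ * (U t * ρ₀ * (U t)ᴴ) - U t * ρ₀ * (U t)ᴴ * H₀ +
          f t • (H₁ * (U t * ρ₀ * (U t)ᴴ) - U t * ρ₀ * (U t)ᴴ * H₁) := by
      rw [← smul_lie_add, Ring.lie_def]
      noncomm_ring
    rw [heq] at this
    exact this

/-- Both identities are closed conditions on `u`, and the bounded continuous controls are dense in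
`L²`. -/
lemma propagator_spec (hT : 0 ≤ T) {H₀ H₁ : Mat n} (hH₀ : IsSu H₀) (hH₁ : IsSu H₁)
    (ρ₀ : Mat n) (u : Control T) :
    (propagator hT H₀ H₁ u)ᴴ * propagator hT H₀ H₁ u = 1 ∧
      endPoint T H₀ H₁ ρ₀ u = propagator hT H₀ H₁ u * ρ₀ * (propagator hT H₀ H₁ u)ᴴ := by
  have hc := continuous_propagator hT H₀ H₁
  have hcs : Continuous fun u => (propagator hT H₀ H₁ u)ᴴ := hc.star
  have hclosed : IsClosed {u : Control T | (propagator hT H₀ H₁ u)ᴴ * propagator hT H₀ H₁ u = 1 ∧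
      endPoint T H₀ H₁ ρ₀ u = propagator hT H₀ H₁ u * ρ₀ * (propagator hT H₀ H₁ u)ᴴ} :=
    (isClosed_eq (hcs.mul hc) continuous_const).inter
      (isClosed_eq (differentiable_endPoint hT H₀ H₁ ρ₀).continuous
        ((hc.mul continuous_const).mul hcs))
  have hdense := Lp.boundedContinuousFunction_dense ℝ
    (volume.restrict (Set.Icc (0 : ℝ) T)) (p := 2) (by norm_num)
  refine hclosed.closure_subset_iff.2 ?_ (hdense u)
  intro v hv
  obtain ⟨f, hf⟩ := Lp.mem_boundedContinuousFunction_iff.1 hv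
  refine propagator_of_continuous hT hH₀ hH₁ ρ₀ f.continuous ?_
  have h := f.toContinuousMap.coeFn_toAEEqFun (volume.restrict (Set.Icc (0 : ℝ) T))
  rw [hf] at h
  exact h

/-! ### The orbit and its tangent spaces. -/

/-- Conjugation ignores a scalar phase: multiplying `U` by an `n`-th root of `(det U)⁻¹` makes the
determinant `1`. Such a root needs `n > 0`; for `n = 0` all matrices coincide. -/
lemma mem_orbit_of_unitary (ρ₀ : Mat n) {U : Mat n} (hU : Uᴴ * U = 1) :
    U * ρ₀ * Uᴴ ∈ orbit ρ₀ := by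
  rcases Nat.eq_zero_or_pos n with rfl | hn
  · exact ⟨1, one_mem _, Subsingleton.elim _ _⟩
  have hdet : ‖U.det‖ = 1 := by
    have h := congrArg Matrix.det hU
    rw [Matrix.det_mul, Matrix.det_conjTranspose, Matrix.det_one] at h
    have h2 := congrArg norm h
    rw [norm_mul, norm_star, norm_one] at h2
    nlinarith [norm_nonneg U.det]
  obtain ⟨c, hc⟩ := IsAlgClosed.exists_pow_nat_eq (U.det)⁻¹ hn
  have hcn : ‖c‖ = 1 := by
    have := congrArg norm hc
    rw [norm_pow, norm_inv, hdet, inv_one] at this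
    exact (pow_eq_one_iff_of_nonneg (norm_nonneg c) hn.ne').1 this
  have hcc : star c * c = 1 := by
    have := Complex.conj_mul' c
    rw [hcn] at this
    simpa using this
  refine ⟨c • U, ?_, ?_⟩
  · rw [Matrix.mem_specialUnitaryGroup_iff, Matrix.mem_unitaryGroup_iff']
    constructor
    · rw [Matrix.star_eq_conjTranspose, Matrix.conjTranspose_smul, smul_mul_smul_comm, hU, hcc,
        one_smul]
    · rw [Matrix.det_smul, Fintype.card_fin, hc, inv_mul_cancel₀]
      intro h
      rw [h, norm_zero] at hdet
      exact zero_ne_one hdet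
  · rw [Matrix.conjTranspose_smul, smul_mul_assoc, smul_mul_smul_comm, mul_comm c, hcc, one_smul]

lemma endPoint_mem_orbit (hT : 0 ≤ T) {H₀ H₁ : Mat n} (hH₀ : IsSu H₀) (hH₁ : IsSu H₁)
    (ρ₀ : Mat n) (u : Control T) : endPoint T H₀ H₁ ρ₀ u ∈ orbit ρ₀ := by
  obtain ⟨h1, h2⟩ := propagator_spec hT hH₀ hH₁ ρ₀ u
  rw [h2]
  exact mem_orbit_of_unitary ρ₀ h1

/-- The cost function as a continuous linear form. -/
def costCLM (θ : Mat n) : Mat n →L[ℝ] ℝ :=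
  LinearMap.toContinuousLinearMap
    { toFun := cost θ
      map_add' := fun x y => by simp [cost, add_mul]
      map_smul' := fun c x => by simp [cost] }

lemma hasFDerivAt_cost (θ ρ : Mat n) : HasFDerivAt (cost θ) (costCLM θ) ρ :=
  (costCLM θ).hasFDerivAt

lemma fderiv_cost_apply (θ ρ η : Mat n) : fderiv ℝ (cost θ) ρ η = cost θ η := by
  rw [(hasFDerivAt_cost θ ρ).fderiv]
  rfl

lemma isCriticalState_iff {ρ₀ θ ρ : Mat n} (hρ : ρ ∈ orbit ρ₀) :
    IsCriticalState ρ₀ θ ρ ↔ ∀ η ∈ tangentSpace ρ₀ ρ, cost θ η = 0 := by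
  simp only [IsCriticalState, hρ, true_and, fderiv_cost_apply]

lemma conjTranspose_mul_self_of_mem {U : Mat n}
    (hU : U ∈ Matrix.specialUnitaryGroup (Fin n) ℂ) : Uᴴ * U = 1 :=
  Matrix.mem_unitaryGroup_iff'.1 (Matrix.mem_specialUnitaryGroup_iff.1 hU).1

lemma mul_conjTranspose_self_of_mem {U : Mat n}
    (hU : U ∈ Matrix.specialUnitaryGroup (Fin n) ℂ) : U * Uᴴ = 1 :=
  Matrix.mem_unitaryGroup_iff.1 (Matrix.mem_specialUnitaryGroup_iff.1 hU).1

/-- The orbit is invariant under unitary conjugation. -/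
lemma conj_mem_orbit {ρ₀ ρ U : Mat n} (hU : Uᴴ * U = 1) (hρ : ρ ∈ orbit ρ₀) :
    U * ρ * Uᴴ ∈ orbit ρ₀ := by
  obtain ⟨V, hV, rfl⟩ := hρ
  have h := mem_orbit_of_unitary ρ₀ (U := U * V) (by
    rw [Matrix.conjTranspose_mul, mul_assoc, ← mul_assoc Uᴴ, hU, one_mul,
      conjTranspose_mul_self_of_mem hV])
  simpa only [Matrix.conjTranspose_mul, mul_assoc] using h

lemma isHermitian_of_mem_orbit {ρ₀ ρ : Mat n} (hρ₀ : ρ₀.IsHermitian) (hρ : ρ ∈ orbit ρ₀) :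
    ρ.IsHermitian := by
  obtain ⟨U, -, rfl⟩ := hρ
  exact Matrix.isHermitian_mul_mul_conjTranspose U hρ₀

/-- Conjugation `X ↦ U X Uᴴ`. -/
def conjLinear (U : Mat n) : Mat n →ₗ[ℝ] Mat n where
  toFun X := U * X * Uᴴ
  map_add' X Y := by rw [mul_add, add_mul]
  map_smul' c X := by rw [RingHom.id_apply, mul_smul_comm, smul_mul_assoc]

lemma map_conjLinear_tangentSpace_le (ρ₀ ρ : Mat n) {U : Mat n} (hU : Uᴴ * U = 1) :
    (tangentSpace ρ₀ ρ).map (conjLinear U) ≤ tangentSpace ρ₀ (U * ρ * Uᴴ) := by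
  rw [tangentSpace, Submodule.map_span, Submodule.span_le]
  rintro _ ⟨η, ⟨γ, hγ, rfl, hη⟩, rfl⟩
  exact Submodule.subset_span ⟨fun s => U * γ s * Uᴴ, fun s => conj_mem_orbit hU (hγ s), rfl,
    (hη.const_mul U).mul_const Uᴴ⟩

/-- If `ρ = U ρ₀ Uᴴ`, conjugation by `Uᴴ` embeds the tangent space at `ρ` into the one at `ρ₀`. This
inequality is all that the dimension count for regular controls needs. -/
lemma finrank_tangentSpace_le {ρ₀ ρ : Mat n} (hρ : ρ ∈ orbit ρ₀) :
    Module.finrank ℝ (tangentSpace ρ₀ ρ) ≤ orbitDim ρ₀ := by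
  obtain ⟨U, hU, rfl⟩ := hρ
  have h1 := conjTranspose_mul_self_of_mem hU
  have h2 := mul_conjTranspose_self_of_mem hU
  have hle := map_conjLinear_tangentSpace_le ρ₀ (U * ρ₀ * Uᴴ) (U := Uᴴ)
    (by rw [Matrix.conjTranspose_conjTranspose, h2])
  have heq : Uᴴ * (U * ρ₀ * Uᴴ) * Uᴴᴴ = ρ₀ := by
    rw [Matrix.conjTranspose_conjTranspose, mul_assoc, mul_assoc _ _ U, h1, mul_one, ← mul_assoc,
      h1, one_mul]
  rw [heq] at hle
  have hinj : Function.Injective (conjLinear Uᴴ) := by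
    refine Function.LeftInverse.injective (g := conjLinear U) fun X => ?_
    change U * (Uᴴ * X * Uᴴᴴ) * Uᴴ = X
    rw [Matrix.conjTranspose_conjTranspose, mul_assoc, mul_assoc _ U, h2, mul_one, ← mul_assoc, h2,
      one_mul]
  exact (Submodule.equivMapOfInjective _ hinj _).finrank_eq.trans_le (Submodule.finrank_mono hle)

/-- The derivative in direction `v` is the velocity of the curve `s ↦ End(u + s v)`, which stays in
the orbit. -/
lemma range_fderiv_endPoint_le (hT : 0 ≤ T) {H₀ H₁ : Mat n} (hH₀ : IsSu H₀) (hH₁ : IsSu H₁)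
    (ρ₀ : Mat n) (u : Control T) :
    LinearMap.range (fderiv ℝ (endPoint T H₀ H₁ ρ₀) u).toLinearMap ≤
      tangentSpace ρ₀ (endPoint T H₀ H₁ ρ₀ u) := by
  rintro _ ⟨v, rfl⟩
  refine Submodule.subset_span ⟨fun s => endPoint T H₀ H₁ ρ₀ (u + s • v),
    fun s => endPoint_mem_orbit hT hH₀ hH₁ ρ₀ _, by simp, ?_⟩
  have h := (differentiable_endPoint hT H₀ H₁ ρ₀ u).hasFDerivAt
  exact h.hasLineDerivAt v

lemma range_fderiv_endPoint_eq (hT : 0 ≤ T) {H₀ H₁ : Mat n} (hH₀ : IsSu H₀) (hH₁ : IsSu H₁)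
    (ρ₀ : Mat n) {u : Control T} (hu : IsRegular T H₀ H₁ ρ₀ u) :
    LinearMap.range (fderiv ℝ (endPoint T H₀ H₁ ρ₀) u).toLinearMap =
      tangentSpace ρ₀ (endPoint T H₀ H₁ ρ₀ u) :=
  Submodule.eq_of_le_of_finrank_le (range_fderiv_endPoint_le hT hH₀ hH₁ ρ₀ u)
    ((finrank_tangentSpace_le (endPoint_mem_orbit hT hH₀ hH₁ ρ₀ u)).trans_eq hu.symm)

/-- Chain rule: for a regular `u`, the values of `d𝒥(u)` are the values of `J` on the whole tangent
space. -/
lemma isCriticalControl_iff (hT : 0 ≤ T) {H₀ H₁ : Mat n} (hH₀ : IsSu H₀) (hH₁ : IsSu H₁)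
    (ρ₀ θ : Mat n) {u : Control T} (hu : IsRegular T H₀ H₁ ρ₀ u) :
    IsCriticalControl T H₀ H₁ ρ₀ θ u ↔ IsCriticalState ρ₀ θ (endPoint T H₀ H₁ ρ₀ u) := by
  have hder : HasFDerivAt (controlCost T H₀ H₁ ρ₀ θ)
      ((costCLM θ).comp (fderiv ℝ (endPoint T H₀ H₁ ρ₀) u)) u :=
    (hasFDerivAt_cost θ _).comp u (differentiable_endPoint hT H₀ H₁ ρ₀ u).hasFDerivAt
  rw [isCriticalState_iff (endPoint_mem_orbit hT hH₀ hH₁ ρ₀ u),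
    ← range_fderiv_endPoint_eq hT hH₀ hH₁ ρ₀ hu]
  constructor
  · rintro h _ ⟨v, rfl⟩
    exact DFunLike.congr_fun (hder.unique h) v
  · intro h
    have h0 : (costCLM θ).comp (fderiv ℝ (endPoint T H₀ H₁ ρ₀) u) = 0 :=
      ContinuousLinearMap.ext fun v => h _ ⟨v, rfl⟩
    rwa [h0] at hder

/-! ### Critical states commute with `θ`. -/

/-- Velocity at `0` of `exp(sA) ρ exp(-sA)`. The trace of `A` plays no role, because the orbit is
invariant under all unitary conjugations. -/
lemma lie_mem_tangentSpace {ρ₀ ρ A : Mat n} (hρ : ρ ∈ orbit ρ₀) (hA : Aᴴ = -A) :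
    ⁅A, ρ⁆ ∈ tangentSpace ρ₀ ρ := by
  have hstar : ∀ s : ℝ, (NormedSpace.exp (s • A))ᴴ = NormedSpace.exp (s • -A) := fun s => by
    rw [← Matrix.exp_conjTranspose, Matrix.conjTranspose_smul, hA, star_trivial]
  refine Submodule.subset_span
    ⟨fun s => NormedSpace.exp (s • A) * ρ * NormedSpace.exp (s • -A), fun s => ?_, by simp, ?_⟩
  · have := conj_mem_orbit (U := NormedSpace.exp (s • A)) (by
      rw [hstar, smul_neg, ← Matrix.exp_add_of_commute _ _ (Commute.refl (s • A)).neg_left,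
        neg_add_cancel, NormedSpace.exp_zero]) hρ
    rwa [hstar] at this
  · have h1 := hasDerivAt_exp_smul_const (𝕂 := ℝ) A (0 : ℝ)
    have h2 := hasDerivAt_exp_smul_const (𝕂 := ℝ) (-A) (0 : ℝ)
    have h3 := (h1.mul_const ρ).mul h2
    simp only [zero_smul, NormedSpace.exp_zero, one_mul, mul_one, mul_neg] at h3
    rw [Ring.lie_def, sub_eq_add_neg]
    exact h3

lemma trace_lie_mul (A B C : Mat n) : (⁅A, B⁆ * C).trace = (A * ⁅B, C⁆).trace := by
  rw [Ring.lie_def, Ring.lie_def, sub_mul, mul_sub, Matrix.trace_sub, Matrix.trace_sub,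
    mul_assoc A, mul_assoc B, Matrix.trace_mul_comm B, mul_assoc A]

open ComplexOrder in
-- The commutator `A = [ρ,θ]` is skew-Hermitian, so `[A,ρ]` is a tangent vector. By invariance of
-- the trace form, `tr([A,ρ]θ) = tr(A²) = -tr(Aᴴ A)`, which vanishes only for `A = 0`.
lemma lie_eq_zero_of_cost_eq_zero {ρ₀ θ ρ : Mat n} (hρ : ρ ∈ orbit ρ₀)
    (hρ' : ρ.IsHermitian) (hθ : θ.IsHermitian) (h : ∀ η ∈ tangentSpace ρ₀ ρ, cost θ η = 0) :
    ⁅ρ, θ⁆ = 0 := by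
  have hA : ⁅ρ, θ⁆ᴴ = -⁅ρ, θ⁆ := by
    rw [Ring.lie_def, Matrix.conjTranspose_sub, Matrix.conjTranspose_mul, Matrix.conjTranspose_mul,
      hρ'.eq, hθ.eq, neg_sub]
  have h1 : (⁅⁅ρ, θ⁆, ρ⁆ * θ).trace.re = 0 := h _ (lie_mem_tangentSpace hρ hA)
  have h2 : (⁅⁅ρ, θ⁆, ρ⁆ * θ).trace = -(⁅ρ, θ⁆ᴴ * ⁅ρ, θ⁆).trace := by
    rw [hA, neg_mul, Matrix.trace_neg, neg_neg, trace_lie_mul]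
  rw [h2, Complex.neg_re, neg_eq_zero] at h1
  have h3 := (Matrix.posSemidef_conjTranspose_mul_self ⁅ρ, θ⁆).trace_nonneg
  rw [Complex.nonneg_iff] at h3
  exact Matrix.trace_conjTranspose_mul_self_eq_zero_iff.1 (Complex.ext h1 h3.2.symm)

/-! ### Velocities of isospectral curves, and the converse. -/

open Polynomial in
lemma differentiableAt_aeval {γ : ℝ → Mat n} {s : ℝ} (hγ : DifferentiableAt ℝ γ s) (q : ℂ[X]) :
    DifferentiableAt ℝ (fun s => aeval (γ s) q) s := by
  induction q using Polynomial.induction_on' with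
  | add p q hp hq =>
    simp only [map_add]
    exact hp.add hq
  | monomial k c =>
    simp only [aeval_monomial]
    exact (hγ.fun_pow k).const_mul _

open Polynomial in
lemma aeval_mul_eq_mul_aeval {A B U : Mat n} (h : A * U = U * B) (q : ℂ[X]) :
    aeval A q * U = U * aeval B q := by
  induction q using Polynomial.induction_on' with
  | add p q hp hq => rw [map_add, map_add, add_mul, mul_add, hp, hq]
  | monomial k c =>
    have hk : A ^ k * U = U * B ^ k := by
      induction k with
      | zero => simp
      | succ k ih => rw [pow_succ, mul_assoc, h, ← mul_assoc, ih, pow_succ, mul_assoc]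
    rw [aeval_monomial, aeval_monomial, mul_assoc, hk, Algebra.left_comm]

open Polynomial in
lemma aeval_diagonal (d : Fin n → ℂ) (q : ℂ[X]) :
    aeval (Matrix.diagonal d : Mat n) q = Matrix.diagonal fun i => q.eval (d i) := by
  have h := aeval_algHom_apply (Matrix.diagonalAlgHom (n := Fin n) (α := ℂ) ℂ) d q
  refine h.trans ?_
  change Matrix.diagonal (aeval d q) = _
  congr 1
  ext i
  have := aeval_algHom_apply (Pi.evalAlgHom ℂ (fun _ : Fin n => ℂ) i) d q
  rw [← Polynomial.coe_aeval_eq_eval]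
  exact this.symm

open Polynomial in
/-- The velocity at `diag d` of an isospectral curve vanishes at the entries where `ad (diag d)`
does. -/
lemma apply_eq_zero_of_isospectral {d : Fin n → ℂ} {γ : ℝ → Mat n} {η : Mat n}
    (hγ : ∀ s, ∃ U V : Mat n, U * V = 1 ∧ γ s * U = U * Matrix.diagonal d)
    (h0 : γ 0 = Matrix.diagonal d) (hη : HasDerivAt γ η 0) {i j : Fin n} (hij : d i = d j) :
    η i j = 0 := by
  classical
  -- `(X - d i) q` is the product over the distinct entries of `d`, so it annihilates `diag d`,
  -- while `q (d i) ≠ 0`.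
  let q : ℂ[X] := ∏ μ ∈ (Finset.univ.image d).erase (d i), (X - C μ)
  have hq : ∀ k, ((X - C (d i)) * q).eval (d k) = 0 := fun k => by
    rw [Finset.mul_prod_erase _ (fun μ => X - C μ)
      (Finset.mem_image_of_mem d (Finset.mem_univ i)), eval_prod]
    exact Finset.prod_eq_zero (Finset.mem_image_of_mem d (Finset.mem_univ k)) (by simp)
  have hqi : q.eval (d i) ≠ 0 := by
    rw [eval_prod, Finset.prod_ne_zero_iff]
    intro μ hμ
    rw [eval_sub, eval_X, eval_C, sub_ne_zero]
    exact (Finset.ne_of_mem_erase hμ).symm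
  -- `γ s` is similar to `diag d`, so the same polynomial annihilates it.
  have hzero : ∀ s, (γ s - algebraMap ℂ (Mat n) (d i)) * aeval (γ s) q = 0 := fun s => by
    obtain ⟨U, V, hUV, hU⟩ := hγ s
    have h := aeval_mul_eq_mul_aeval hU ((X - C (d i)) * q)
    rw [aeval_diagonal, funext hq, Matrix.diagonal_zero, mul_zero] at h
    have h2 := congrArg (· * V) h
    simp only [mul_assoc, hUV, mul_one, zero_mul] at h2
    rwa [map_mul, map_sub, aeval_X, aeval_C] at h2
  have hd := (hη.sub_const (algebraMap ℂ (Mat n) (d i))).mul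
    (differentiableAt_aeval hη.differentiableAt q).hasDerivAt
  have hd0 : HasDerivAt (fun s => (γ s - algebraMap ℂ (Mat n) (d i)) * aeval (γ s) q) 0 0 := by
    simp only [hzero]
    exact hasDerivAt_const _ _
  have heq := hd.unique hd0
  rw [h0, aeval_diagonal, Matrix.algebraMap_eq_diagonal, Matrix.diagonal_sub] at heq
  -- Entry `(i, j)` of the differentiated identity: the term with the derivative of `q (γ s)`
  -- carries the factor `d i - d i = 0`, leaving `η i j * q (d j)`, where `d j = d i`.
  have hent := congrFun (congrFun heq i) j
  rw [Matrix.add_apply, Matrix.mul_diagonal, Matrix.diagonal_mul] at hent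
  simp only [Pi.algebraMap_apply, Algebra.algebraMap_self, RingHom.id_apply, sub_self, zero_mul,
    add_zero, Matrix.zero_apply, ← hij] at hent
  exact (mul_eq_zero.1 hent).resolve_right hqi

/-- In an eigenbasis `W` of `ρ`, the rotated `η` and `θ` have complementary supports: `η` vanishes
where `d i = d j`, and `θ`, commuting with `diag d`, vanishes where `d i ≠ d j`. Every term of the
trace is therefore zero. -/
lemma cost_eq_zero_of_lie_eq_zero {ρ₀ θ ρ : Mat n} (hρ : ρ ∈ orbit ρ₀) (hρ' : ρ.IsHermitian)
    (hlie : ⁅ρ, θ⁆ = 0) : ∀ η ∈ tangentSpace ρ₀ ρ, cost θ η = 0 := by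
  suffices h : tangentSpace ρ₀ ρ ≤ LinearMap.ker (costCLM θ).toLinearMap from fun η hη => h hη
  refine Submodule.span_le.2 ?_
  rintro η ⟨γ, hγ, hγ0, hη⟩
  change (η * θ).trace.re = 0
  obtain ⟨W, d, hW, hW', hd⟩ : ∃ (W : Mat n) (d : Fin n → ℂ), Wᴴ * W = 1 ∧ W * Wᴴ = 1 ∧
      ρ = W * Matrix.diagonal d * Wᴴ :=
    ⟨hρ'.eigenvectorUnitary, _, Unitary.coe_star_mul_self _, Unitary.coe_mul_star_self _,
      hρ'.spectral_theorem⟩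
  have hd' : Wᴴ * ρ * W = Matrix.diagonal d := by
    rw [hd, mul_assoc, mul_assoc _ _ W, hW, mul_one, ← mul_assoc, hW, one_mul]
  have hent : ∀ i j, d i = d j → (Wᴴ * η * W) i j = 0 := fun i j hij => by
    refine apply_eq_zero_of_isospectral (γ := fun s => Wᴴ * γ s * W) (d := d) (fun s => ?_)
      (by rw [hγ0, hd']) ((hη.const_mul Wᴴ).mul_const W) hij
    obtain ⟨U, hU, hUs⟩ := hγ s
    obtain ⟨V, hV, hVs⟩ := hρ
    have hU1 := conjTranspose_mul_self_of_mem hU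
    have hU2 := mul_conjTranspose_self_of_mem hU
    have hV1 := conjTranspose_mul_self_of_mem hV
    have hV2 := mul_conjTranspose_self_of_mem hV
    have hρ₀ : ρ₀ = Vᴴ * ρ * V := by
      rw [hVs, mul_assoc, mul_assoc _ _ V, hV1, mul_one, ← mul_assoc, hV1, one_mul]
    -- `U Vᴴ` conjugates `ρ = V ρ₀ Vᴴ` into `γ s = U ρ₀ Uᴴ`; it and its inverse `V Uᴴ` are written
    -- in the basis `W`.
    refine ⟨Wᴴ * U * Vᴴ * W, Wᴴ * V * Uᴴ * W, ?_, ?_⟩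
    · calc Wᴴ * U * Vᴴ * W * (Wᴴ * V * Uᴴ * W)
          = Wᴴ * U * (Vᴴ * (W * Wᴴ) * V) * Uᴴ * W := by simp only [mul_assoc]
        _ = Wᴴ * (U * Uᴴ) * W := by rw [hW', mul_one, hV1, mul_one]; simp only [mul_assoc]
        _ = 1 := by rw [hU2, mul_one, hW]
    · rw [hUs, ← hd']
      calc Wᴴ * (U * ρ₀ * Uᴴ) * W * (Wᴴ * U * Vᴴ * W)
          = Wᴴ * U * ρ₀ * (Uᴴ * (W * Wᴴ) * U) * Vᴴ * W := by simp only [mul_assoc]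
        _ = Wᴴ * U * Vᴴ * ρ * (V * Vᴴ) * W := by
          rw [hW', mul_one, hU1, mul_one, hρ₀]; simp only [mul_assoc]
        _ = Wᴴ * U * Vᴴ * (W * Wᴴ) * ρ * W := by rw [hV2, hW', mul_one, mul_one]
        _ = Wᴴ * U * Vᴴ * W * (Wᴴ * ρ * W) := by simp only [mul_assoc]
  have hcomm : Matrix.diagonal d * (Wᴴ * θ * W) = Wᴴ * θ * W * Matrix.diagonal d := by
    rw [Ring.lie_def, sub_eq_zero] at hlie
    rw [← hd']
    calc Wᴴ * ρ * W * (Wᴴ * θ * W) = Wᴴ * ρ * (W * Wᴴ) * θ * W := by simp only [mul_assoc]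
      _ = Wᴴ * (ρ * θ) * W := by rw [hW', mul_one]; simp only [mul_assoc]
      _ = Wᴴ * θ * (W * Wᴴ) * ρ * W := by rw [hlie, hW', mul_one]; simp only [mul_assoc]
      _ = Wᴴ * θ * W * (Wᴴ * ρ * W) := by simp only [mul_assoc]
  have htr : (η * θ).trace = (Wᴴ * η * W * (Wᴴ * θ * W)).trace := by
    calc (η * θ).trace = (η * θ * (W * Wᴴ)).trace := by rw [hW', mul_one]
      _ = (Wᴴ * η * 1 * θ * W).trace := by
        rw [← mul_assoc, Matrix.trace_mul_comm, mul_one]; simp only [mul_assoc]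
      _ = (Wᴴ * η * W * (Wᴴ * θ * W)).trace := by rw [← hW']; simp only [mul_assoc]
  have hz : (η * θ).trace = 0 := by
    rw [htr, Matrix.trace]
    refine Finset.sum_eq_zero fun i _ => ?_
    rw [Matrix.diag_apply, Matrix.mul_apply]
    refine Finset.sum_eq_zero fun j _ => ?_
    by_cases hij : d i = d j
    · rw [hent i j hij, zero_mul]
    -- Entry `(j, i)` of the commutation relation says that `(d i - d j)` times that entry of the
    -- rotated `θ` is zero.
    · have h := congrFun (congrFun hcomm j) i
      rw [Matrix.diagonal_mul, Matrix.mul_diagonal, mul_comm, ← sub_eq_zero, ← mul_sub] at h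
      rw [(mul_eq_zero.1 h).resolve_right (sub_ne_zero.2 (Ne.symm hij)), mul_zero]
  rw [hz, Complex.zero_re]

end QuantumControl

end

/-! ### The equivalence of the three conditions. -/

theorem mainTheorem11 (n : ℕ) (T : ℝ) (hT : 0 < T)
    (H₀ H₁ ρ₀ θ : QuantumControl.Mat n)
    (hH₀ : QuantumControl.IsSu H₀) (hH₁ : QuantumControl.IsSu H₁)
    (hρ₀ : ρ₀.IsHermitian) (hθ : θ.IsHermitian)
    (u : QuantumControl.Control T) (hu : QuantumControl.IsRegular T H₀ H₁ ρ₀ u) :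
    (QuantumControl.IsCriticalControl T H₀ H₁ ρ₀ θ u ↔
      QuantumControl.IsCriticalState ρ₀ θ (QuantumControl.endPoint T H₀ H₁ ρ₀ u)) ∧
    (QuantumControl.IsCriticalState ρ₀ θ (QuantumControl.endPoint T H₀ H₁ ρ₀ u) ↔
      ⁅QuantumControl.endPoint T H₀ H₁ ρ₀ u, θ⁆ = 0) := by
  have hmem := QuantumControl.endPoint_mem_orbit hT.le hH₀ hH₁ ρ₀ u
  have hherm := QuantumControl.isHermitian_of_mem_orbit hρ₀ hmem
  refine ⟨QuantumControl.isCriticalControl_iff hT.le hH₀ hH₁ ρ₀ θ hu, ?_⟩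
  rw [QuantumControl.isCriticalState_iff hmem]
  exact ⟨QuantumControl.lie_eq_zero_of_cost_eq_zero hmem hherm hθ,
    QuantumControl.cost_eq_zero_of_lie_eq_zero hmem hherm⟩
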